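/- Let $S=\mathbb{C}[z_1,\dots,z_n]$, and let $M\subsetneq S$ be a proper monomial ideal such that $S/M$ is Artinian. Suppose that $z_1^{b_1},\dots,z_n^{b_n}$ are among the minimal monomial generators of $M$, and put $N=(z_1^{b_1},\dots,z_n^{b_n})$. A polyhedral cell complex is a finite set $X$ of convex polytopes (the empty polytope allowed) that contains every face of each of its members and is such that the intersection of two members is a face of both; its members are called its faces, and $|X|$ denotes their union. It is labeled if each vertex $v$ carries a monomial $m_v$; a face $\sigma$ then has the label $m_\sigma=\operatorname{lcm}\{m_v : v \text{ a vertex in } \sigma\}$, with $m_\emptyset=1$. A labeled complex $X$ refines a labeled complex $Y$ if $|X|=|Y|$, each face of $Y$ is a union of faces of $X$, and $m_{\sigma'}\mid m_\sigma$ whenever $\sigma'\in X$, $\sigma\in Y$ and $\sigma'\subseteq\sigma$. For a monomial ideal $I$ and $t>1$ write $t^\alpha=(t^{\alpha_1},\dots,t^{\alpha_n})$ and let $\mathcal{P}_t(I)\subset\mathbb{R}^n$ be the convex hull of $\{t^\alpha : z^\alpha\in I\}$. The hull complex $\operatorname{hull}(I)$ is the polyhedral cell complex of all bounded faces of $\mathcal{P}_t(I)$,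 for $t$ sufficiently large. Each of its vertices is $t^\alpha$ for a minimal monomial generator $z^\alpha$ of $I$, and is labeled by $z^\alpha$. Then, for all sufficiently large $t$, the following holds for $\operatorname{hull}(M)$ and $\operatorname{hull}(N)$, both realized with this $t$. Let $\mathbf{1}=(1,\dots,1)$ and let $\Delta$ be the simplex with vertices $v_1=(t^{b_1},1,\dots,1),\dots,v_n=(1,\dots,1,t^{b_n})$. For each $p\in|\operatorname{hull}(M)|$ the line through $\mathbf{1}$ and $p$ meets $\Delta$ in exactly one point $\pi(p)$. The map $\pi$ is continuous and injective on $|\operatorname{hull}(M)|$. The images $\pi(\sigma)$ of the faces $\sigma$ of $\operatorname{hull}(M)$ are the faces of a polyhedral cell complex, whose vertices are the points $\pi(v)$ with $v$ a vertex of $\operatorname{hull}(M)$. With $\pi(v)$ labeled by $m_v$, this labeled complex refines $\operatorname{hull}(N)$ as labeled polyhedral cell complexes. -/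

import Mathlib

open Filter Topology

/-- A polyhedral cell complex in a real normed space `E`: a finite collection of convex polytopes
(convex hulls of finite sets, the empty polytope being allowed), closed under taking faces, such
that the intersection of two members is a face of both.  A face of a polytope `σ` is the
intersection of `σ` with a supporting hyperplane, that is, the set where a linear functional
attains its maximum on `σ`; `σ` itself and `∅` count as faces.  This is `IsExposed ℝ σ τ`. -/
structure PolyhedralComplex (E : Type*) [NormedAddCommGroup E] [NormedSpace ℝ E] where
  faces : Set (Set E)
  finite_faces : faces.Finite
  polytope : ∀ σ ∈ faces, ∃ s : Set E, s.Finite ∧ σ = convexHull ℝ s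
  face_mem : ∀ σ ∈ faces, ∀ τ, IsExposed ℝ σ τ → τ ∈ faces
  inter_face : ∀ σ ∈ faces, ∀ τ ∈ faces, IsExposed ℝ σ (σ ∩ τ) ∧ IsExposed ℝ τ (σ ∩ τ)

namespace PolyhedralComplex

variable {E : Type*} [NormedAddCommGroup E] [NormedSpace ℝ E]

/-- The union `|X|` of all faces of `X`. -/
def support (X : PolyhedralComplex E) : Set E := ⋃₀ X.faces

/-- The vertices of `X`, i.e. its faces of dimension `0`. -/
def vertices (X : PolyhedralComplex E) : Set E := {v | {v} ∈ X.faces}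

theorem finite_vertices (X : PolyhedralComplex E) : X.vertices.Finite :=
  X.finite_faces.preimage Set.singleton_injective.injOn

/-- `X` refines `Y`: `|X| = |Y|` and each face of `Y` is a union of faces of `X`. -/
def Refines (X Y : PolyhedralComplex E) : Prop :=
  X.support = Y.support ∧ ∀ σ ∈ Y.faces, ∃ T ⊆ X.faces, σ = ⋃₀ T

end PolyhedralComplex

/-- A labeled polyhedral cell complex: each vertex carries a monomial `z ^ α` in `n` variables,
given by its exponent vector `α`.  For exponent vectors, divisibility is `≤` and the least common
multiple is `⊔`. -/
structure LabeledPolyhedralComplex (E : Type*) [NormedAddCommGroup E] [NormedSpace ℝ E] (n : ℕ)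
    extends PolyhedralComplex E where
  label : toPolyhedralComplex.vertices → (Fin n →₀ ℕ)

namespace LabeledPolyhedralComplex

variable {E : Type*} [NormedAddCommGroup E] [NormedSpace ℝ E] {n : ℕ}

theorem finite_vertices_in (X : LabeledPolyhedralComplex E n) (σ : Set E) :
    {v : X.vertices | (v : E) ∈ σ}.Finite :=
  haveI : Finite X.vertices := X.finite_vertices
  Set.toFinite _

/-- The label `m_σ` of a face `σ`: the least common multiple of the labels of the vertices in `σ`
(so `m_∅ = 1`, with exponent vector `0`). -/
noncomputable def faceLabel (X : LabeledPolyhedralComplex E n) (σ : Set E) : Fin n →₀ ℕ :=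
  (X.finite_vertices_in σ).toFinset.sup X.label

/-- `X` refines `Y` as labeled polyhedral cell complexes: it does so as polyhedral cell complexes,
and `m_σ'` divides `m_σ` whenever `σ' ∈ X`, `σ ∈ Y` and `σ' ⊆ σ`. -/
def Refines (X Y : LabeledPolyhedralComplex E n) : Prop :=
  X.toPolyhedralComplex.Refines Y.toPolyhedralComplex ∧
    ∀ σ' ∈ X.faces, ∀ σ ∈ Y.faces, σ' ⊆ σ → X.faceLabel σ' ≤ Y.faceLabel σ

/-- The map `f` embeds `X` with image the labeled complex `X'`: it is continuous and injective on
the compact set `|X|` (hence a homeomorphism onto its image), the faces of `X'` are precisely the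
images `f(σ)` of the faces `σ` of `X`, and vertices are sent to vertices with the same label. -/
structure IsEmbedding (f : E → E) (X X' : LabeledPolyhedralComplex E n) : Prop where
  continuousOn : ContinuousOn f X.support
  injOn : Set.InjOn f X.support
  faces_eq : X'.faces = (fun σ => f '' σ) '' X.faces
  label_eq : ∀ v : X.vertices, ∃ h : f v ∈ X'.vertices, X'.label ⟨f v, h⟩ = X.label v

end LabeledPolyhedralComplex

namespace HullComplex

variable {n : ℕ}

/-- A monomial ideal: an ideal of `ℂ[z₁, …, zₙ]` that can be generated by monomials. -/
def IsMonomialIdeal (M : Ideal (MvPolynomial (Fin n) ℂ)) : Prop :=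
  ∃ A : Set (Fin n →₀ ℕ), M = Ideal.span ((fun α => MvPolynomial.monomial α (1 : ℂ)) '' A)

/-- `z ^ α` is a minimal monomial generator of `M`: it lies in `M` and is minimal for divisibility
among the monomials in `M`. -/
def IsMinimalGenerator (M : Ideal (MvPolynomial (Fin n) ℂ)) (α : Fin n →₀ ℕ) : Prop :=
  Minimal (fun β => MvPolynomial.monomial β (1 : ℂ) ∈ M) α

/-- The point `t ^ α = (t ^ α₁, …, t ^ αₙ)` of `ℝⁿ`. -/
def expPoint (t : ℝ) (α : Fin n →₀ ℕ) : Fin n → ℝ := fun i => t ^ α i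

/-- The polyhedron `𝒫_t(M)`, the convex hull of the points `t ^ α` with `z ^ α ∈ M`. -/
def polyhedron (M : Ideal (MvPolynomial (Fin n) ℂ)) (t : ℝ) : Set (Fin n → ℝ) :=
  convexHull ℝ (expPoint t '' {α | MvPolynomial.monomial α (1 : ℂ) ∈ M})

/-- The bounded faces of the polyhedron `𝒫_t(M)`. -/
def boundedFaces (M : Ideal (MvPolynomial (Fin n) ℂ)) (t : ℝ) : Set (Set (Fin n → ℝ)) :=
  {F | IsExposed ℝ (polyhedron M t) F ∧ Bornology.IsBounded F}

theorem finite_minimalGenerators (M : Ideal (MvPolynomial (Fin n) ℂ)) :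
    {α | IsMinimalGenerator M α}.Finite :=
  WellQuasiOrderedLE.finite_of_isAntichain (setOfPred_minimal_antichain _)

theorem exists_minimalGenerator_le {M : Ideal (MvPolynomial (Fin n) ℂ)} {α : Fin n →₀ ℕ}
    (h : MvPolynomial.monomial α (1 : ℂ) ∈ M) : ∃ γ ≤ α, IsMinimalGenerator M γ :=
  exists_minimal_le_of_wellFoundedLT _ α h

theorem monomial_mem_of_le {M : Ideal (MvPolynomial (Fin n) ℂ)} {α β : Fin n →₀ ℕ}
    (h : MvPolynomial.monomial α (1 : ℂ) ∈ M) (hle : α ≤ β) :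
    MvPolynomial.monomial β (1 : ℂ) ∈ M := by
  refine Ideal.mem_of_dvd M ?_ h
  rw [MvPolynomial.monomial_dvd_monomial]
  exact ⟨Or.inr hle, dvd_refl _⟩

/-- The points of a convex hull where a linear functional attains an upper bound of its values on
the generating set form the convex hull of the generators where it is attained. -/
theorem mem_convexHull_of_attained {E : Type*} [NormedAddCommGroup E] [NormedSpace ℝ E]
    (l : StrongDual ℝ E) (S : Set E) (m : ℝ) (hm : ∀ x ∈ S, l x ≤ m) {x : E}
    (hx : x ∈ convexHull ℝ S) : l x ≤ m ∧ (m ≤ l x → x ∈ convexHull ℝ {y ∈ S | l y = m}) := by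
  have hsub : S ⊆ {x | l x ≤ m ∧ (m ≤ l x → x ∈ convexHull ℝ {y ∈ S | l y = m})} := fun y hy =>
    ⟨hm y hy, fun h => subset_convexHull ℝ _ ⟨hy, le_antisymm (hm y hy) h⟩⟩
  refine convexHull_min hsub ?_ hx
  rintro y ⟨hy, hy'⟩ z ⟨hz, hz'⟩ a b ha hb hab
  have e : l (a • y + b • z) = a * l y + b * l z := by simp
  obtain rfl : b = 1 - a := by linarith
  refine ⟨by rw [e]; nlinarith [mul_nonneg ha (sub_nonneg.2 hy), mul_nonneg hb (sub_nonneg.2 hz)],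
    fun h => ?_⟩
  rw [e] at h
  rcases ha.eq_or_lt with rfl | ha
  · simpa using hz' (by linarith)
  rcases hb.eq_or_lt with hb0 | hb
  · obtain rfl : a = 1 := by linarith
    simpa using hy' (by linarith)
  have h1 : m ≤ l y := by
    by_contra! hc
    nlinarith [mul_pos ha (sub_pos.2 hc), mul_nonneg hb.le (sub_nonneg.2 hz)]
  have h2 : m ≤ l z := by
    by_contra! hc
    nlinarith [mul_pos hb (sub_pos.2 hc), mul_nonneg ha.le (sub_nonneg.2 hy)]
  exact convex_convexHull ℝ _ (hy' h1) (hz' h2) ha.le hb.le hab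

/-- The polyhedron is closed under moving in the positive coordinate directions. -/
theorem add_single_mem {M : Ideal (MvPolynomial (Fin n) ℂ)} {t : ℝ} (ht : 1 < t) (i : Fin n)
    {s : ℝ} (hs : 0 ≤ s) {x : Fin n → ℝ} (hx : x ∈ polyhedron M t) :
    x + s • Pi.single i 1 ∈ polyhedron M t := by
  have hconv : Convex ℝ {x | x + s • Pi.single i (1 : ℝ) ∈ polyhedron M t} := by
    intro y hy z hz a b ha hb hab
    have h := convex_convexHull ℝ _ hy hz ha hb hab
    have e : a • (y + s • Pi.single i (1 : ℝ)) + b • (z + s • Pi.single i (1 : ℝ)) =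
        a • y + b • z + s • Pi.single i (1 : ℝ) := by
      rw [smul_add, smul_add, add_add_add_comm, ← add_smul, hab, one_smul]
    rw [e] at h
    exact h
  refine convexHull_min ?_ hconv hx
  rintro _ ⟨α, hα, rfl⟩
  obtain ⟨k, hk⟩ := pow_unbounded_of_one_lt (t ^ α i + s) ht
  have hα' : MvPolynomial.monomial (α + Finsupp.single i k) (1 : ℂ) ∈ M :=
    monomial_mem_of_le hα le_self_add
  have ht0 : 0 < t := by linarith
  have hpos : 0 < t ^ α i := pow_pos ht0 _
  have hge : t ^ k ≤ t ^ (α i + k) := pow_le_pow_right₀ ht.le (by omega)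
  set d := t ^ (α i + k) - t ^ α i with hd
  have hdpos : 0 < d := by linarith
  have hsd : s / d ≤ 1 := by
    rw [div_le_one hdpos]
    linarith
  have h := convex_convexHull ℝ (expPoint t '' {α | MvPolynomial.monomial α (1 : ℂ) ∈ M})
    (subset_convexHull ℝ _ ⟨α, hα, rfl⟩) (subset_convexHull ℝ _ ⟨_, hα', rfl⟩)
    (sub_nonneg.2 hsd) (div_nonneg hs hdpos.le) (by ring)
  show _ ∈ convexHull ℝ _
  convert h using 1
  funext j
  rcases eq_or_ne j i with rfl | hj
  · simp only [expPoint, Pi.add_apply, Pi.smul_apply, Pi.single_eq_same, smul_eq_mul,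
      Finsupp.add_apply, Finsupp.single_eq_same, mul_one]
    have : t ^ (α j + k) = d + t ^ α j := by rw [hd]; ring
    rw [this]
    field_simp
    ring
  · simp [expPoint, hj, Finsupp.single_eq_of_ne hj]
    ring

/-- A functional whose maximum on the polyhedron is attained on a bounded nonempty set is
negative in every coordinate direction. -/
theorem neg_of_bounded {M : Ideal (MvPolynomial (Fin n) ℂ)} {t : ℝ} (ht : 1 < t)
    {l : StrongDual ℝ (Fin n → ℝ)} {x : Fin n → ℝ}
    (hx : x ∈ {x ∈ polyhedron M t | ∀ y ∈ polyhedron M t, l y ≤ l x})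
    (hb : Bornology.IsBounded {x ∈ polyhedron M t | ∀ y ∈ polyhedron M t, l y ≤ l x})
    (i : Fin n) : l (Pi.single i 1) < 0 := by
  have h1 := hx.2 _ (add_single_mem ht i zero_le_one hx.1)
  rw [one_smul, map_add] at h1
  refine lt_of_le_of_ne (by linarith) fun h0 => ?_
  obtain ⟨C, hC⟩ := hb.exists_norm_le
  have h2 : x + (C + 1 + |x i|) • Pi.single i (1 : ℝ) ∈
      {x ∈ polyhedron M t | ∀ y ∈ polyhedron M t, l y ≤ l x} := by
    have hC0 : 0 ≤ C := (norm_nonneg _).trans (hC x hx)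
    refine ⟨add_single_mem ht i (by positivity) hx.1, fun y hy => ?_⟩
    rw [map_add, map_smul, h0]
    simpa using hx.2 y hy
  have h3 := (norm_le_pi_norm _ i).trans (hC _ h2)
  simp only [Pi.add_apply, Pi.smul_apply, Pi.single_eq_same, smul_eq_mul, mul_one,
    Real.norm_eq_abs] at h3
  have := (abs_le.1 h3).2
  have := neg_abs_le (x i)
  linarith

theorem functional_le {t : ℝ} (ht : 1 < t) {l : StrongDual ℝ (Fin n → ℝ)}
    (hl : ∀ i, l (Pi.single i 1) < 0) {γ α : Fin n →₀ ℕ} (h : γ ≤ α) :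
    l (expPoint t α) ≤ l (expPoint t γ) ∧ (l (expPoint t γ) ≤ l (expPoint t α) → γ = α) := by
  have e : ∀ x : Fin n → ℝ, l x = ∑ i, x i * l (Pi.single i 1) := fun x => by
    conv_lhs => rw [pi_eq_sum_univ' x]
    simp [map_sum]
  have hle : ∀ i ∈ Finset.univ, expPoint t α i * l (Pi.single i 1) ≤
      expPoint t γ i * l (Pi.single i 1) := fun i _ =>
    mul_le_mul_of_nonpos_right (pow_le_pow_right₀ ht.le (h i)) (hl i).le
  rw [e, e (expPoint t γ)]
  refine ⟨Finset.sum_le_sum hle, fun hge => ?_⟩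
  have heq := (Finset.sum_eq_sum_iff_of_le hle).1 (le_antisymm (Finset.sum_le_sum hle) hge)
  ext i
  have h1 := mul_right_cancel₀ (hl i).ne (heq i (Finset.mem_univ i))
  exact (pow_right_injective₀ (by linarith) ht.ne' h1).symm

/-- A nonempty set of maximal points of a functional that is negative in all coordinate directions
is the convex hull of points given by minimal generators. -/
theorem argmax_eq_convexHull {M : Ideal (MvPolynomial (Fin n) ℂ)} {t : ℝ} (ht : 1 < t)
    {l : StrongDual ℝ (Fin n → ℝ)} (hl : ∀ i, l (Pi.single i 1) < 0) {m : ℝ}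
    (hm : ∀ γ, IsMinimalGenerator M γ → l (expPoint t γ) ≤ m) {x : Fin n → ℝ}
    (hx : x ∈ polyhedron M t) :
    l x ≤ m ∧ (m ≤ l x →
      x ∈ convexHull ℝ (expPoint t '' {γ | IsMinimalGenerator M γ ∧ l (expPoint t γ) = m})) := by
  have h := mem_convexHull_of_attained l _ m (by
    rintro _ ⟨α, hα, rfl⟩
    obtain ⟨γ, hγ, hγm⟩ := exists_minimalGenerator_le hα
    exact (functional_le ht hl hγ).1.trans (hm γ hγm)) hx
  refine ⟨h.1, fun hge => convexHull_mono ?_ (h.2 hge)⟩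
  rintro _ ⟨⟨α, hα, rfl⟩, hα'⟩
  obtain ⟨γ, hγ, hγm⟩ := exists_minimalGenerator_le hα
  obtain rfl := (functional_le ht hl hγ).2 (hα' ▸ hm γ hγm)
  exact ⟨γ, ⟨hγm, hα'⟩, rfl⟩

theorem expPoint_mem {M : Ideal (MvPolynomial (Fin n) ℂ)} {γ : Fin n →₀ ℕ} (t : ℝ)
    (h : IsMinimalGenerator M γ) : expPoint t γ ∈ polyhedron M t :=
  subset_convexHull ℝ _ ⟨γ, h.1, rfl⟩

/-- A bounded face is the convex hull of the points of the minimal generators that it contains. -/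
theorem boundedFace_eq {M : Ideal (MvPolynomial (Fin n) ℂ)} {t : ℝ} (ht : 1 < t)
    {F : Set (Fin n → ℝ)} (hF : F ∈ boundedFaces M t) :
    F = convexHull ℝ (expPoint t '' {γ | IsMinimalGenerator M γ ∧ expPoint t γ ∈ F}) := by
  rcases F.eq_empty_or_nonempty with rfl | hne
  · simp
  refine Set.Subset.antisymm (fun x hx => ?_) ?_
  · obtain ⟨l, rfl⟩ := hF.1 hne
    have hl := neg_of_bounded ht hx hF.2
    refine convexHull_mono ?_ ((argmax_eq_convexHull ht hl (m := l x)
      (fun γ hγ => hx.2 _ (expPoint_mem t hγ)) hx.1).2 le_rfl)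
    rintro _ ⟨γ, ⟨hγ, hγx⟩, rfl⟩
    exact ⟨γ, ⟨hγ, expPoint_mem t hγ, fun y hy => hγx ▸ hx.2 y hy⟩, rfl⟩
  · refine convexHull_min ?_ (hF.1.convex (convex_convexHull ℝ _))
    rintro _ ⟨γ, hγ, rfl⟩
    exact hγ.2

theorem finite_boundedFaces (M : Ideal (MvPolynomial (Fin n) ℂ)) {t : ℝ} (ht : 1 < t) :
    (boundedFaces M t).Finite := by
  refine ((finite_minimalGenerators M).finite_subsets.image
    fun G => convexHull ℝ (expPoint t '' G)).subset fun F hF => ?_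
  exact ⟨{γ | IsMinimalGenerator M γ ∧ expPoint t γ ∈ F}, fun γ hγ => hγ.1,
    (boundedFace_eq ht hF).symm⟩

/-- A face of a bounded face of the polyhedron is a bounded face of the polyhedron. -/
theorem face_mem_boundedFaces {M : Ideal (MvPolynomial (Fin n) ℂ)} {t : ℝ} (ht : 1 < t)
    {F G : Set (Fin n → ℝ)} (hF : F ∈ boundedFaces M t) (hG : IsExposed ℝ F G) :
    G ∈ boundedFaces M t := by
  refine ⟨fun hne => ?_, hF.2.subset hG.subset⟩
  obtain ⟨x, hx⟩ := hne
  have hxF := hG.subset hx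
  obtain ⟨l', rfl⟩ := hG ⟨x, hx⟩
  obtain ⟨l, rfl⟩ := hF.1 ⟨x, hxF⟩
  have hl := neg_of_bounded ht hxF hF.2
  have hlim : ∀ y, Tendsto (fun ε : ℝ => l y + ε * l' y) (𝓝[>] 0) (𝓝 (l y)) := fun y => by
    have : Tendsto (fun ε : ℝ => l y + ε * l' y) (𝓝 0) (𝓝 (l y + 0 * l' y)) :=
      (Continuous.tendsto (by fun_prop) 0)
    simpa using this.mono_left nhdsWithin_le_nhds
  have h1 : ∀ᶠ ε : ℝ in 𝓝[>] 0, ∀ i, l (Pi.single i 1) + ε * l' (Pi.single i 1) < 0 :=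
    eventually_all.2 fun i => (hlim _).eventually_lt_const (hl i)
  have h2 : ∀ᶠ ε : ℝ in 𝓝[>] 0, ∀ γ ∈ {α | IsMinimalGenerator M α},
      l (expPoint t γ) < l x →
        l (expPoint t γ) + ε * l' (expPoint t γ) < l x + ε * l' x := by
    refine (finite_minimalGenerators M).eventually_all.2 fun γ _ => ?_
    by_cases h : l (expPoint t γ) < l x
    · filter_upwards [(hlim (expPoint t γ)).eventually_lt (hlim x) h] with ε hε _ using hε
    · exact Eventually.of_forall fun ε h' => absurd h' h
  obtain ⟨ε, hε1, hε2, hε⟩ := (h1.and (h2.and self_mem_nhdsWithin)).exists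
  have hε : 0 < ε := hε
  have hval : ∀ y, (l + ε • l') y = l y + ε * l' y := fun y => by simp
  have hmemF : ∀ γ, IsMinimalGenerator M γ → l x ≤ l (expPoint t γ) →
      expPoint t γ ∈ {x ∈ polyhedron M t | ∀ y ∈ polyhedron M t, l y ≤ l x} :=
    fun γ hγ h => ⟨expPoint_mem t hγ, fun y hy => (hxF.2 y hy).trans h⟩
  have hub : ∀ γ, IsMinimalGenerator M γ → (l + ε • l') (expPoint t γ) ≤ (l + ε • l') x := by
    intro γ hγ
    rw [hval, hval]
    rcases lt_or_ge (l (expPoint t γ)) (l x) with h | h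
    · exact (hε2 γ hγ h).le
    · have := hx.2 _ (hmemF γ hγ h)
      have := hxF.2 _ (expPoint_mem t hγ)
      nlinarith
  have hmain := fun y (hy : y ∈ polyhedron M t) => argmax_eq_convexHull ht
    (l := l + ε • l') (fun i => by rw [hval]; exact hε1 i) (m := (l + ε • l') x) hub hy
  refine ⟨l + ε • l', Set.Subset.antisymm (fun y hy => ?_) (fun y hy => ?_)⟩
  · refine ⟨hy.1.1, fun z hz => (hmain z hz).1.trans ?_⟩
    rw [hval, hval]
    have := hy.2 x hxF
    have := hy.1.2 x hxF.1
    nlinarith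
  · have hy' := (hmain y hy.1).2 (hy.2 x hxF.1)
    refine convexHull_min ?_ (hG.convex (hF.1.convex (convex_convexHull ℝ _))) hy'
    rintro _ ⟨γ, ⟨hγ, hγx⟩, rfl⟩
    rw [hval, hval] at hγx
    have hge : l x ≤ l (expPoint t γ) := by
      by_contra! h
      exact (hε2 γ hγ h).ne hγx
    have hle := hxF.2 _ (expPoint_mem t hγ)
    refine ⟨hmemF γ hγ hge, fun z hz => (hx.2 z hz).trans ?_⟩
    nlinarith

/-- Each vertex of the complex of bounded faces is `t ^ γ` for a minimal generator `z ^ γ`. -/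
theorem exists_generator_of_vertex {M : Ideal (MvPolynomial (Fin n) ℂ)} {t : ℝ} (ht : 1 < t)
    {v : Fin n → ℝ} (hv : {v} ∈ boundedFaces M t) :
    ∃ γ, IsMinimalGenerator M γ ∧ expPoint t γ = v := by
  have h := boundedFace_eq ht hv
  by_contra! hc
  have he : {γ | IsMinimalGenerator M γ ∧ expPoint t γ ∈ ({v} : Set (Fin n → ℝ))} = ∅ :=
    Set.eq_empty_of_forall_notMem fun γ hγ => hc γ hγ.1 hγ.2
  rw [he] at h
  simp at h

/-- The complex `hull(M)` realized with the parameter `t > 1`: the bounded faces of `𝒫_t(M)`, the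
vertex `t ^ γ` being labeled by the minimal generator `z ^ γ` of `M`.  The hull complex is this
complex for `t` sufficiently large. -/
noncomputable def hull (M : Ideal (MvPolynomial (Fin n) ℂ)) (t : ℝ) (ht : 1 < t) :
    LabeledPolyhedralComplex (Fin n → ℝ) n where
  faces := boundedFaces M t
  finite_faces := finite_boundedFaces M ht
  polytope _ hF := ⟨_, ((finite_minimalGenerators M).subset fun _ h => h.1).image _,
    boundedFace_eq ht hF⟩
  face_mem _ hF _ hG := face_mem_boundedFaces ht hF hG
  inter_face _ hF _ hG :=
    ⟨(hF.1.inter hG.1).mono hF.1.subset Set.inter_subset_left,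
      (hF.1.inter hG.1).mono hG.1.subset Set.inter_subset_right⟩
  label v := (exists_generator_of_vertex ht v.2).choose

/-- The complete intersection ideal `(z₁ ^ b₁, …, zₙ ^ bₙ)`. -/
noncomputable def powerIdeal (b : Fin n → ℕ) : Ideal (MvPolynomial (Fin n) ℂ) :=
  Ideal.span (Set.range fun i => MvPolynomial.X i ^ b i)

/-- The simplex `Δ` with vertices `(1, …, 1, t ^ bᵢ, 1, …, 1)`, `i = 1, …, n`. -/
def simplex (b : Fin n → ℕ) (t : ℝ) : Set (Fin n → ℝ) :=
  convexHull ℝ (Set.range fun i => expPoint t (Finsupp.single i (b i)))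

end HullComplex

/-! ### Central projection: convex hulls and exposed faces -/

section CentralProjection

variable {E : Type*} [NormedAddCommGroup E] [NormedSpace ℝ E]

/-! The map `π` is the central projection from `1` to the hyperplane `ψ (x - 1) = 1` spanned by `Δ`,
and every `t > 1` works. The polyhedron lies in `1` plus the nonnegative orthant and, as `M` is
proper, misses `1`. A nonempty bounded face is where some `l`, negative in all coordinate
directions, is maximal. So `l (x - 1) < 0` on the polyhedron, and `l` strictly decreases along rays
from `1` into it: such a ray meets the bounded faces at most once (`injOn_centralProj`).

Conversely, a ray in a strictly positive direction does meet them: separate the hull of the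
generator points from the open orthant below the first point of the ray that dominates a point of
that hull. The pure powers in `M` force the separating functional to be strictly positive, so it
cuts out a bounded face (`exists_ray_mem_support`). Compactness then gives all of `Δ`
(`image_centralProj_support`).

Each face lies in a hyperplane off `1`, where the projection is projective and respects faces; this
gives the image complex (`mapCentralProj`). The projection preserves each condition `x i = 1`, and
those conditions cut out the faces of `Δ`. Hence a face of `Δ` is covered by images of coordinate
faces of `hull M`. A vertex `t ^ γ` projecting into it has `γ i = 0` off its index set, while
minimality gives `γ i ≤ b i`; this is the divisibility of labels. -/

/-- The projection with centre `c` to the hyperplane `ψ (x - c) = 1`. -/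
noncomputable def centralProj (c : E) (ψ : StrongDual ℝ E) (p : E) : E :=
  c + (ψ (p - c))⁻¹ • (p - c)

variable {c : E} {ψ : StrongDual ℝ E}

theorem smul_centralProj_sub {x : E} (hx : 0 < ψ (x - c)) :
    ψ (x - c) • (centralProj c ψ x - c) = x - c := by
  rw [centralProj, add_sub_cancel_left, smul_smul, mul_inv_cancel₀ hx.ne', one_smul]

theorem continuousOn_centralProj : ContinuousOn (centralProj c ψ) {x | 0 < ψ (x - c)} := by
  unfold centralProj
  refine continuousOn_const.add (ContinuousOn.smul (ContinuousOn.inv₀ ?_ ?_) ?_)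
  · fun_prop
  · exact fun x hx => ne_of_gt hx
  · fun_prop

/-- The projection is fractional linear: it keeps segments but multiplies the weights by the values
of `ψ` and renormalizes. -/
theorem centralProj_combo {x y : E} (hx : 0 < ψ (x - c)) (hy : 0 < ψ (y - c)) {a b : ℝ}
    (ha : 0 ≤ a) (hb : 0 ≤ b) (hab : a + b = 1) :
    0 < a * ψ (x - c) + b * ψ (y - c) ∧
    centralProj c ψ (a • x + b • y) =
      (a * ψ (x - c) / (a * ψ (x - c) + b * ψ (y - c))) • centralProj c ψ x +
      (b * ψ (y - c) / (a * ψ (x - c) + b * ψ (y - c))) • centralProj c ψ y := by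
  have e : a • x + b • y - c = a • (x - c) + b • (y - c) := by
    obtain rfl : b = 1 - a := by linarith
    module
  have hpos : 0 < a * ψ (x - c) + b * ψ (y - c) := by
    rcases ha.eq_or_lt with rfl | ha
    · obtain rfl : b = 1 := by linarith
      simpa using hy
    · have := mul_nonneg hb hy.le
      have := mul_pos ha hx
      linarith
  refine ⟨hpos, ?_⟩
  have e2 : ψ (a • x + b • y - c) = a * ψ (x - c) + b * ψ (y - c) := by
    rw [e]; simp only [map_add, map_smul, smul_eq_mul]
  rw [centralProj, e2, e]
  unfold centralProj
  set p := ψ (x - c)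
  set q := ψ (y - c)
  set D := a * p + b * q with hD
  have h1 : a * p / D + b * q / D = 1 := by
    rw [← add_div, ← hD, div_self hpos.ne']
  rw [smul_add (a * p / D), smul_add (b * q / D), add_add_add_comm, ← add_smul, h1, one_smul,
    smul_smul, smul_smul, smul_add, smul_smul, smul_smul]
  congr 3 <;> field_simp

/-- Dividing the weights by the values of `ψ` and renormalizing inverts the change of weights in
`centralProj_combo`. -/
theorem Convex.image_centralProj {C : Set E} (hC : Convex ℝ C) (hpos : ∀ x ∈ C, 0 < ψ (x - c)) :
    Convex ℝ (centralProj c ψ '' C) := by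
  rintro _ ⟨x, hx, rfl⟩ _ ⟨y, hy, rfl⟩ a b ha hb hab
  have hp := hpos x hx
  have hq := hpos y hy
  set p := ψ (x - c) with hp'
  set q := ψ (y - c) with hq'
  have hD : 0 < a / p + b / q := by
    rcases ha.eq_or_lt with rfl | ha
    · obtain rfl : b = 1 := by linarith
      simpa using hq
    · have := div_nonneg hb hq.le
      have := div_pos ha hp
      linarith
  have ha' : 0 ≤ a / p / (a / p + b / q) := div_nonneg (div_nonneg ha hp.le) hD.le
  have hb' : 0 ≤ b / q / (a / p + b / q) := div_nonneg (div_nonneg hb hq.le) hD.le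
  have hab' : a / p / (a / p + b / q) + b / q / (a / p + b / q) = 1 := by
    rw [← add_div, div_self hD.ne']
  refine ⟨_, hC hx hy ha' hb' hab', ?_⟩
  rw [(centralProj_combo (hpos x hx) (hpos y hy) ha' hb' hab').2, ← hp', ← hq']
  have e1 : a / p / (a / p + b / q) * p = a / (a / p + b / q) := by field_simp
  have e2 : b / q / (a / p + b / q) * q = b / (a / p + b / q) := by field_simp
  have e3 : a / (a / p + b / q) + b / (a / p + b / q) = 1 / (a / p + b / q) := by
    rw [← add_div, hab]
  rw [e1, e2, e3, div_div_div_cancel_right₀ hD.ne', div_div_div_cancel_right₀ hD.ne', div_one,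
    div_one]

theorem centralProj_image_convexHull {s : Set E} (hpos : ∀ x ∈ convexHull ℝ s, 0 < ψ (x - c)) :
    centralProj c ψ '' convexHull ℝ s = convexHull ℝ (centralProj c ψ '' s) := by
  refine Set.Subset.antisymm ?_ (convexHull_min (Set.image_mono (subset_convexHull ℝ s))
    ((convex_convexHull ℝ s).image_centralProj hpos))
  -- Membership in the hull is carried along because `centralProj_combo` needs positivity at both
  -- endpoints.
  have hconv : Convex ℝ {x | x ∈ convexHull ℝ s ∧
      centralProj c ψ x ∈ convexHull ℝ (centralProj c ψ '' s)} := by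
    rintro x ⟨hx, hx'⟩ y ⟨hy, hy'⟩ a b ha hb hab
    refine ⟨convex_convexHull ℝ s hx hy ha hb hab, ?_⟩
    obtain ⟨hD, h⟩ := centralProj_combo (hpos x hx) (hpos y hy) ha hb hab
    rw [h]
    refine convex_convexHull ℝ _ hx' hy' (div_nonneg (mul_nonneg ha (hpos x hx).le) hD.le)
      (div_nonneg (mul_nonneg hb (hpos y hy).le) hD.le) ?_
    rw [← add_div, div_self hD.ne']
  rintro _ ⟨x, hx, rfl⟩
  have hsub : s ⊆ {x | x ∈ convexHull ℝ s ∧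
      centralProj c ψ x ∈ convexHull ℝ (centralProj c ψ '' s)} := fun y hy =>
    ⟨subset_convexHull ℝ s hy, subset_convexHull ℝ _ (Set.mem_image_of_mem _ hy)⟩
  exact (convexHull_min hsub hconv hx).2

/-- Every exposed face of a central projection is the projection of an exposed face. -/
theorem exists_isExposed_of_centralProj {A G : Set E} (hpos : ∀ x ∈ A, 0 < ψ (x - c))
    (hG : IsExposed ℝ (centralProj c ψ '' A) G) :
    ∃ F, IsExposed ℝ A F ∧ centralProj c ψ '' F = G := by
  rcases G.eq_empty_or_nonempty with rfl | hne
  · exact ⟨∅, fun h => absurd h Set.not_nonempty_empty, by simp⟩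
  obtain ⟨l, rfl⟩ := hG hne
  obtain ⟨_, ⟨x₀, hx₀, rfl⟩, hmax⟩ := hne
  -- With this `m`, the values of `l - m • ψ` on `A`, relative to its value at `c`, are those of `l`
  -- on the image, relative to the maximum, times the positive factor `ψ (x - c)`. So both are
  -- maximal at corresponding points.
  set m := l (centralProj c ψ x₀ - c) with hm
  have key : ∀ x ∈ A, l x - m * ψ x - (l c - m * ψ c) =
      ψ (x - c) * (l (centralProj c ψ x) - l (centralProj c ψ x₀)) := by
    intro x hx
    have h := congrArg l (smul_centralProj_sub (hpos x hx))
    have h2 : l (centralProj c ψ x) - l (centralProj c ψ x₀) = l (centralProj c ψ x - c) - m := by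
      rw [hm, map_sub, map_sub]; ring
    rw [map_smul, smul_eq_mul, map_sub l x c] at h
    rw [h2, mul_sub, h, map_sub]
    ring
  have hval : ∀ x, (l - m • ψ) x = l x - m * ψ x := fun x => by simp
  have key0 := key x₀ hx₀
  rw [sub_self, mul_zero] at key0
  refine ⟨{x ∈ A | ∀ y ∈ A, (l - m • ψ) y ≤ (l - m • ψ) x}, fun _ => ⟨_, rfl⟩, ?_⟩
  ext z
  constructor
  · rintro ⟨x, ⟨hx, hx'⟩, rfl⟩
    refine ⟨⟨x, hx, rfl⟩, fun y hy => (hmax y hy).trans ?_⟩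
    have h1 := hx' x₀ hx₀
    rw [hval, hval] at h1
    have h2 := key x hx
    have h3 : 0 ≤ ψ (x - c) * (l (centralProj c ψ x) - l (centralProj c ψ x₀)) := by linarith
    linarith [nonneg_of_mul_nonneg_right h3 (hpos x hx)]
  · rintro ⟨⟨x, hx, rfl⟩, hx'⟩
    refine ⟨x, ⟨hx, fun y hy => ?_⟩, rfl⟩
    have h1 := hx' _ ⟨x₀, hx₀, rfl⟩
    have h2 := hmax _ ⟨y, hy, rfl⟩
    rw [hval, hval]
    have h3 := mul_nonneg (hpos x hx).le (sub_nonneg.2 h1)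
    have h4 := mul_nonneg (hpos y hy).le (sub_nonneg.2 h2)
    have h5 := key x hx
    have h6 := key y hy
    linarith

/-- Central projection of a set in a hyperplane off the centre maps exposed faces to exposed
faces. -/
theorem IsExposed.image_centralProj {A F : Set E} (hpos : ∀ x ∈ A, 0 < ψ (x - c))
    {l₀ : StrongDual ℝ E} {k : ℝ} (hk : k ≠ 0) (hl₀ : ∀ x ∈ A, l₀ (x - c) = k)
    (hF : IsExposed ℝ A F) : IsExposed ℝ (centralProj c ψ '' A) (centralProj c ψ '' F) := by
  rintro ⟨_, x₀, hx₀, rfl⟩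
  obtain ⟨l, rfl⟩ := hF ⟨x₀, hx₀⟩
  obtain ⟨hx₀, hmax⟩ := hx₀
  -- On `A` the functional `l₀` is constant, so subtracting `r • l₀` does not change where `l` is
  -- maximal. This `r` makes the maximum equal to the value at `c`; rescaling from `c` then
  -- preserves signs.
  set r := l (x₀ - c) / k with hr
  have key : ∀ x ∈ A, l x - l x₀ = ψ (x - c) *
      ((l - r • l₀) (centralProj c ψ x) - (l - r • l₀) c) := by
    intro x hx
    rw [← map_sub (l - r • l₀), ← smul_eq_mul, ← map_smul, smul_centralProj_sub (hpos x hx)]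
    simp only [sub_apply, smul_apply, smul_eq_mul]
    rw [hl₀ x hx, hr, div_mul_cancel₀ _ hk, map_sub, map_sub]
    ring
  have key0 : (l - r • l₀) (centralProj c ψ x₀) - (l - r • l₀) c = 0 := by
    have := key x₀ hx₀
    rw [sub_self] at this
    exact (mul_eq_zero.1 this.symm).resolve_left (hpos x₀ hx₀).ne'
  refine ⟨l - r • l₀, ?_⟩
  ext z
  constructor
  · rintro ⟨x, ⟨hx, hx'⟩, rfl⟩
    refine ⟨⟨x, hx, rfl⟩, ?_⟩
    rintro _ ⟨y, hy, rfl⟩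
    have h1 := key x hx
    have h2 := key y hy
    have h3 : 0 ≤ ψ (x - c) * ((l - r • l₀) (centralProj c ψ x) - (l - r • l₀) c) := by
      linarith [hx' x₀ hx₀]
    have h4 : 0 ≤ ψ (y - c) * -((l - r • l₀) (centralProj c ψ y) - (l - r • l₀) c) := by
      rw [mul_neg]
      linarith [hmax y hy]
    have h5 := nonneg_of_mul_nonneg_right h3 (hpos x hx)
    have h6 := nonneg_of_mul_nonneg_right h4 (hpos y hy)
    linarith
  · rintro ⟨⟨x, hx, rfl⟩, hx'⟩
    refine ⟨x, ⟨hx, fun y hy => (hmax y hy).trans ?_⟩, rfl⟩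
    have h1 := hx' _ ⟨x₀, hx₀, rfl⟩
    have h2 := key x hx
    have := mul_nonneg (hpos x hx).le (sub_nonneg.2 h1)
    have e : (l - r • l₀) (centralProj c ψ x₀) = (l - r • l₀) c := by linarith
    rw [e] at this
    linarith

end CentralProjection

/-! ### Projecting a labeled complex -/

namespace LabeledPolyhedralComplex

variable {E : Type*} [NormedAddCommGroup E] [NormedSpace ℝ E] {n : ℕ}
  (X : LabeledPolyhedralComplex E n) {c : E} {ψ : StrongDual ℝ E}

theorem exists_vertex_of_image_eq_singleton {f : E → E} (hinj : Set.InjOn f X.support) {w : E}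
    (hw : {w} ∈ (fun σ => f '' σ) '' X.faces) : ∃ v : X.vertices, f v = w := by
  obtain ⟨σ, hσ, h⟩ := hw
  obtain ⟨v, hv, hvw⟩ : w ∈ f '' σ := by
    rw [show f '' σ = {w} from h]; rfl
  have e : σ = {v} := by
    refine Set.Subset.antisymm (fun y hy => ?_) (Set.singleton_subset_iff.2 hv)
    have : f y = w := by
      have h2 : f y ∈ f '' σ := ⟨y, hy, rfl⟩
      rwa [show f '' σ = {w} from h] at h2
    exact hinj ⟨σ, hσ, hy⟩ ⟨σ, hσ, hv⟩ (this.trans hvw.symm)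
  exact ⟨⟨v, show {v} ∈ X.faces from e ▸ hσ⟩, hvw⟩

/-- The central projection of a labeled complex. -/
noncomputable def mapCentralProj (hpos : ∀ x ∈ X.support, 0 < ψ (x - c))
    (hinj : Set.InjOn (centralProj c ψ) X.support)
    (hplane : ∀ σ ∈ X.faces, ∃ (l₀ : StrongDual ℝ E) (k : ℝ), k ≠ 0 ∧ ∀ x ∈ σ, l₀ (x - c) = k) :
    LabeledPolyhedralComplex E n where
  faces := (fun σ => centralProj c ψ '' σ) '' X.faces
  finite_faces := X.finite_faces.image _
  polytope := by
    rintro _ ⟨σ, hσ, rfl⟩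
    obtain ⟨s, hs, e⟩ := X.polytope σ hσ
    refine ⟨centralProj c ψ '' s, hs.image _, ?_⟩
    show centralProj c ψ '' σ = _
    rw [e]
    exact centralProj_image_convexHull fun x hx => hpos x ⟨σ, hσ, e ▸ hx⟩
  face_mem := by
    rintro _ ⟨σ, hσ, rfl⟩ G hG
    obtain ⟨F, hF, rfl⟩ := exists_isExposed_of_centralProj (fun x hx => hpos x ⟨σ, hσ, hx⟩) hG
    exact ⟨F, X.face_mem σ hσ F hF, rfl⟩
  inter_face := by
    rintro _ ⟨σ, hσ, rfl⟩ _ ⟨τ, hτ, rfl⟩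
    have e : centralProj c ψ '' σ ∩ centralProj c ψ '' τ = centralProj c ψ '' (σ ∩ τ) :=
      (hinj.image_inter (fun x hx => ⟨σ, hσ, hx⟩) (fun x hx => ⟨τ, hτ, hx⟩)).symm
    obtain ⟨h1, h2⟩ := X.inter_face σ hσ τ hτ
    -- A common face of `σ` and `τ` stays a face after projection because each lies in a hyperplane
    -- missing the centre.
    obtain ⟨l₁, k₁, hk₁, hl₁⟩ := hplane σ hσ
    obtain ⟨l₂, k₂, hk₂, hl₂⟩ := hplane τ hτ
    show IsExposed ℝ (centralProj c ψ '' σ) (centralProj c ψ '' σ ∩ centralProj c ψ '' τ) ∧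
      IsExposed ℝ (centralProj c ψ '' τ) (centralProj c ψ '' σ ∩ centralProj c ψ '' τ)
    rw [e]
    exact ⟨h1.image_centralProj (fun x hx => hpos x ⟨σ, hσ, hx⟩) hk₁ hl₁,
      h2.image_centralProj (fun x hx => hpos x ⟨τ, hτ, hx⟩) hk₂ hl₂⟩
  -- By `hinj` the preimage vertex is unique, so the choice is immaterial.
  label w := X.label (X.exists_vertex_of_image_eq_singleton hinj w.2).choose

variable {X} {hpos : ∀ x ∈ X.support, 0 < ψ (x - c)}
  {hinj : Set.InjOn (centralProj c ψ) X.support}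
  {hplane : ∀ σ ∈ X.faces, ∃ (l₀ : StrongDual ℝ E) (k : ℝ), k ≠ 0 ∧ ∀ x ∈ σ, l₀ (x - c) = k}

theorem exists_vertex_mapCentralProj (w : (X.mapCentralProj hpos hinj hplane).vertices) :
    ∃ v : X.vertices, centralProj c ψ v = w ∧
      (X.mapCentralProj hpos hinj hplane).label w = X.label v :=
  ⟨_, (X.exists_vertex_of_image_eq_singleton hinj w.2).choose_spec, rfl⟩

theorem isEmbedding_mapCentralProj :
    IsEmbedding (centralProj c ψ) X (X.mapCentralProj hpos hinj hplane) where
  continuousOn := continuousOn_centralProj.mono hpos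
  injOn := hinj
  faces_eq := rfl
  label_eq v := by
    have h : centralProj c ψ v ∈ (X.mapCentralProj hpos hinj hplane).vertices :=
      ⟨{(v : E)}, v.2, Set.image_singleton⟩
    refine ⟨h, ?_⟩
    obtain ⟨v', hv', e⟩ := exists_vertex_mapCentralProj ⟨_, h⟩
    rw [e]
    have : v' = v := Subtype.ext (hinj ⟨_, v'.2, rfl⟩ ⟨_, v.2, rfl⟩ hv')
    rw [this]

theorem support_mapCentralProj :
    (X.mapCentralProj hpos hinj hplane).support = centralProj c ψ '' X.support := by
  show ⋃₀ ((fun σ => centralProj c ψ '' σ) '' X.faces) = centralProj c ψ '' ⋃₀ X.faces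
  rw [Set.sUnion_image, Set.sUnion_eq_biUnion, Set.image_iUnion₂]

end LabeledPolyhedralComplex

theorem PolyhedralComplex.isCompact_support {E : Type*} [NormedAddCommGroup E] [NormedSpace ℝ E]
    (X : PolyhedralComplex E) : IsCompact X.support := by
  refine X.finite_faces.isCompact_sUnion fun σ hσ => ?_
  obtain ⟨s, hs, rfl⟩ := X.polytope σ hσ
  exact hs.isCompact_convexHull ℝ

/-! ### Functionals on `ℝⁿ` and the faces of the simplex -/

namespace HullComplex

variable {n : ℕ}

theorem functional_apply_eq_sum (l : StrongDual ℝ (Fin n → ℝ)) (x : Fin n → ℝ) :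
    l x = ∑ i, x i * l (Pi.single i 1) := by
  conv_lhs => rw [pi_eq_sum_univ' x]
  simp [map_sum]

theorem functional_pos {l : StrongDual ℝ (Fin n → ℝ)} (hl : ∀ i, 0 < l (Pi.single i 1))
    {x : Fin n → ℝ} (hx : ∀ i, 0 ≤ x i) (hne : x ≠ 0) : 0 < l x := by
  obtain ⟨j, hj⟩ := Function.ne_iff.1 hne
  rw [functional_apply_eq_sum]
  exact Finset.sum_pos' (fun i _ => mul_nonneg (hx i) (hl i).le)
    ⟨j, Finset.mem_univ j, mul_pos (lt_of_le_of_ne (hx j) (Ne.symm hj)) (hl j)⟩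

/-- The functional `x ↦ ∑ xᵢ / (t ^ bᵢ - 1)`, which takes the value `1` at `v - 1` for each vertex
`v` of the simplex `Δ`. -/
noncomputable def simplexFunctional (b : Fin n → ℕ) (t : ℝ) : StrongDual ℝ (Fin n → ℝ) :=
  ∑ i, (t ^ b i - 1)⁻¹ • ContinuousLinearMap.proj i

theorem simplexFunctional_apply (b : Fin n → ℕ) (t : ℝ) (x : Fin n → ℝ) :
    simplexFunctional b t x = ∑ i, (t ^ b i - 1)⁻¹ * x i := by
  simp [simplexFunctional]

theorem simplexFunctional_single (b : Fin n → ℕ) (t : ℝ) (i : Fin n) :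
    simplexFunctional b t (Pi.single i 1) = (t ^ b i - 1)⁻¹ := by
  rw [simplexFunctional_apply, Finset.sum_eq_single i]
  · simp
  · intro j _ hj
    simp [hj]
  · simp

theorem pow_sub_one_pos {t : ℝ} (ht : 1 < t) {k : ℕ} (hk : k ≠ 0) : 0 < t ^ k - 1 :=
  sub_pos.2 (one_lt_pow₀ ht hk)

theorem one_le_expPoint {t : ℝ} (ht : 1 < t) (α : Fin n →₀ ℕ) (i : Fin n) : 1 ≤ expPoint t α i :=
  one_le_pow₀ ht.le

theorem expPoint_injective {t : ℝ} (ht : 1 < t) :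
    Function.Injective (expPoint t : (Fin n →₀ ℕ) → Fin n → ℝ) := fun α β h => by
  ext i
  exact pow_right_injective₀ (by linarith) ht.ne' (congrFun h i)

theorem expPoint_single (t : ℝ) (i : Fin n) (k : ℕ) :
    expPoint t (Finsupp.single i k) = 1 + (t ^ k - 1) • Pi.single i (1 : ℝ) := by
  funext j
  rcases eq_or_ne j i with rfl | hj
  · simp [expPoint]
  · simp [expPoint, hj, Finsupp.single_eq_of_ne hj]

theorem expPoint_single_ne (t : ℝ) {i j : Fin n} (hj : j ≠ i) (k : ℕ) :
    expPoint t (Finsupp.single i k) j = 1 := by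
  simp [expPoint, Finsupp.single_eq_of_ne hj]

section Simplex

variable {b : Fin n → ℕ} {t : ℝ} (hb : ∀ i, b i ≠ 0) (ht : 1 < t)
include hb ht

theorem simplexFunctional_single_pos (i : Fin n) :
    0 < simplexFunctional b t (Pi.single i 1) := by
  rw [simplexFunctional_single]
  exact inv_pos.2 (pow_sub_one_pos ht (hb i))

theorem simplexFunctional_vertex (i : Fin n) :
    simplexFunctional b t (expPoint t (Finsupp.single i (b i)) - 1) = 1 := by
  rw [expPoint_single, add_sub_cancel_left, map_smul, simplexFunctional_single, smul_eq_mul,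
    mul_inv_cancel₀ (pow_sub_one_pos ht (hb i)).ne']

/-- The face of the simplex `Δ` spanned by the vertices with index in `J`, by inequalities. -/
theorem mem_convexHull_vertices (J : Set (Fin n)) {x : Fin n → ℝ} :
    x ∈ convexHull ℝ ((fun i => expPoint t (Finsupp.single i (b i))) '' J) ↔
      (∀ i, 1 ≤ x i) ∧ simplexFunctional b t (x - 1) = 1 ∧ ∀ j ∉ J, x j = 1 := by
  constructor
  · intro hx
    have hconv : Convex ℝ {x : Fin n → ℝ | (∀ i, 1 ≤ x i) ∧
        simplexFunctional b t (x - 1) = 1 ∧ ∀ j ∉ J, x j = 1} := by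
      rintro x ⟨hx1, hx2, hx3⟩ y ⟨hy1, hy2, hy3⟩ p q hp hq hpq
      obtain rfl : q = 1 - p := by linarith
      refine ⟨fun i => ?_, ?_, fun j hj => ?_⟩
      · simp only [Pi.add_apply, Pi.smul_apply, smul_eq_mul]
        nlinarith [hx1 i, hy1 i]
      · have e : p • x + (1 - p) • y - 1 = p • (x - 1) + (1 - p) • (y - 1) := by module
        rw [e, map_add, map_smul, map_smul, hx2, hy2]
        simp
      · simp [hx3 j hj, hy3 j hj]
    refine convexHull_min ?_ hconv hx
    rintro _ ⟨i, hi, rfl⟩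
    exact ⟨one_le_expPoint ht _, simplexFunctional_vertex hb ht i, fun j hj =>
      expPoint_single_ne t (ne_of_mem_of_not_mem hi hj).symm _⟩
  · rintro ⟨h1, h2, h3⟩
    classical
    -- The barycentric coordinates of `x`: they sum to `1` by the hyperplane equation and vanish off
    -- `J`.
    set w : Fin n → ℝ := fun i => (t ^ b i - 1)⁻¹ * (x i - 1) with hw
    have hw0 : ∀ i ∉ J, w i = 0 := fun i hi => by simp [hw, h3 i hi]
    have hsum : ∑ i, w i = 1 := by
      rw [← h2, simplexFunctional_apply]
      rfl
    have hx : x = ∑ i, w i • expPoint t (Finsupp.single i (b i)) := by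
      have e : ∑ i, w i • expPoint t (Finsupp.single i (b i)) =
          ∑ i, (w i • (1 : Fin n → ℝ) + (x i - 1) • Pi.single i (1 : ℝ)) := by
        refine Finset.sum_congr rfl fun i _ => ?_
        rw [expPoint_single, smul_add, smul_smul]
        have : w i * (t ^ b i - 1) = x i - 1 := by
          rw [hw]
          have := (pow_sub_one_pos ht (hb i)).ne'
          field_simp
        rw [this]
      rw [e, Finset.sum_add_distrib, ← Finset.sum_smul, hsum, one_smul]
      have := pi_eq_sum_univ' (x - 1)
      simp only [Pi.sub_apply, Pi.one_apply] at this
      rw [← sub_eq_iff_eq_add']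
      convert this using 3
    have hfilter : ∀ f : Fin n → (Fin n → ℝ), ∑ i, w i • f i = ∑ i with i ∈ J, w i • f i := by
      intro f
      rw [Finset.sum_filter]
      refine Finset.sum_congr rfl fun i _ => ?_
      split_ifs with h
      · rfl
      · rw [hw0 i h, zero_smul]
    rw [hx, hfilter]
    refine (convex_convexHull ℝ _).sum_mem (fun i _ => ?_) ?_ (fun i hi => ?_)
    · exact mul_nonneg (inv_pos.2 (pow_sub_one_pos ht (hb i))).le (sub_nonneg.2 (h1 i))
    · rw [← hsum, Finset.sum_filter]
      refine Finset.sum_congr rfl fun i _ => ?_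
      split_ifs with h
      · rfl
      · rw [hw0 i h]
    · exact subset_convexHull ℝ _ ⟨i, (Finset.mem_filter.1 hi).2, rfl⟩

theorem mem_simplex {x : Fin n → ℝ} :
    x ∈ simplex b t ↔ (∀ i, 1 ≤ x i) ∧ simplexFunctional b t (x - 1) = 1 := by
  rw [simplex, ← Set.image_univ, mem_convexHull_vertices hb ht]
  simp

end Simplex

theorem one_le_of_mem_polyhedron {M : Ideal (MvPolynomial (Fin n) ℂ)} {t : ℝ} (ht : 1 < t)
    {x : Fin n → ℝ} (hx : x ∈ polyhedron M t) (i : Fin n) : 1 ≤ x i := by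
  have hconv : Convex ℝ {x : Fin n → ℝ | 1 ≤ x i} := by
    intro x hx y hy p q hp hq hpq
    simp only [Set.mem_ofPred_eq, Pi.add_apply, Pi.smul_apply, smul_eq_mul] at *
    nlinarith
  refine convexHull_min ?_ hconv hx
  rintro _ ⟨α, -, rfl⟩
  exact one_le_expPoint ht α i

theorem convex_le_functional_sub {E : Type*} [NormedAddCommGroup E] [NormedSpace ℝ E]
    (l : StrongDual ℝ E) (c : E) (m : ℝ) : Convex ℝ {x | m ≤ l (x - c)} := by
  intro x hx y hy p q hp hq hpq
  obtain rfl : q = 1 - p := by linarith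
  have e : p • x + (1 - p) • y - c = p • (x - c) + (1 - p) • (y - c) := by module
  simp only [Set.mem_ofPred_eq] at *
  rw [e, map_add, map_smul, map_smul, smul_eq_mul, smul_eq_mul]
  nlinarith

/-- The set where the coordinates outside `J` are equal to their lower bound is a face. -/
theorem isExposed_coordinates {A : Set (Fin n → ℝ)} (hA : ∀ x ∈ A, ∀ i, 1 ≤ x i)
    (J : Set (Fin n)) : IsExposed ℝ A {x ∈ A | ∀ j ∉ J, x j = 1} := by
  classical
  rintro ⟨x₀, hx₀, hx₀'⟩
  -- The sum of the coordinates outside `J`; since `x₀` attains the lower bound in each of them, the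
  -- sum is minimal only where all are equal to `1`.
  set l : StrongDual ℝ (Fin n → ℝ) := ∑ j with j ∉ J, ContinuousLinearMap.proj (R := ℝ) j with hl
  have hval : ∀ x, (-l) x = -∑ j with j ∉ J, x j := fun x => by
    simp [hl]
  have hge : ∀ x ∈ A, ∑ j with j ∉ J, (1 : ℝ) ≤ ∑ j with j ∉ J, x j := fun x hx =>
    Finset.sum_le_sum fun j _ => hA x hx j
  have h0 : ∀ x : Fin n → ℝ, (∀ j ∉ J, x j = 1) →
      ∑ j with j ∉ J, x j = ∑ j with j ∉ J, (1 : ℝ) := fun x hx =>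
    Finset.sum_congr rfl fun j hj => hx j (Finset.mem_filter.1 hj).2
  refine ⟨-l, Set.ext fun x => ⟨?_, ?_⟩⟩
  · rintro ⟨hx, hx'⟩
    refine ⟨hx, fun y hy => ?_⟩
    rw [hval, hval, h0 x hx']
    exact neg_le_neg (hge y hy)
  · rintro ⟨hx, hx'⟩
    refine ⟨hx, fun j hj => ?_⟩
    have h := hx' x₀ hx₀
    rw [hval, hval, h0 x₀ hx₀'] at h
    have := (Finset.sum_eq_sum_iff_of_le fun j _ => hA x hx j).1
      (le_antisymm (hge x hx) (neg_le_neg_iff.1 h)) j (Finset.mem_filter.2 ⟨Finset.mem_univ j, hj⟩)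
    exact this.symm

/-! ### The hull complex of the power ideal -/

section PowerIdeal

variable {b : Fin n → ℕ}

theorem monomial_mem_powerIdeal_iff {α : Fin n →₀ ℕ} :
    MvPolynomial.monomial α (1 : ℂ) ∈ powerIdeal b ↔ ∃ i, Finsupp.single i (b i) ≤ α := by
  have e : powerIdeal b = Ideal.span ((fun s => MvPolynomial.monomial s (1 : ℂ)) ''
      Set.range fun i => Finsupp.single i (b i)) := by
    rw [powerIdeal, ← Set.range_comp]
    congr 2
    funext i
    simp [MvPolynomial.X_pow_eq_monomial]
  rw [e, MvPolynomial.mem_ideal_span_monomial_image, MvPolynomial.support_monomial]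
  simp

theorem IsMinimalGenerator.eq_single {γ : Fin n →₀ ℕ} (h : IsMinimalGenerator (powerIdeal b) γ) :
    ∃ i, γ = Finsupp.single i (b i) := by
  obtain ⟨i, hi⟩ := monomial_mem_powerIdeal_iff.1 h.1
  exact ⟨i, h.eq_of_le (monomial_mem_powerIdeal_iff.2 ⟨i, le_rfl⟩) hi |>.symm⟩

variable {t : ℝ}

/-- All minimal generators are pure powers, so each face is spanned by vertices of `Δ`;
`mem_convexHull_vertices` then describes it by inequalities. -/
theorem boundedFace_powerIdeal_eq (ht : 1 < t) {σ : Set (Fin n → ℝ)}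
    (hσ : σ ∈ boundedFaces (powerIdeal b) t) :
    σ = convexHull ℝ ((fun i => expPoint t (Finsupp.single i (b i))) ''
      {i | expPoint t (Finsupp.single i (b i)) ∈ σ}) := by
  refine Set.Subset.antisymm ?_ (convexHull_min ?_ (hσ.1.convex (convex_convexHull ℝ _)))
  · conv_lhs => rw [boundedFace_eq ht hσ]
    refine convexHull_mono ?_
    rintro _ ⟨γ, ⟨hγ, hγσ⟩, rfl⟩
    obtain ⟨i, rfl⟩ := hγ.eq_single
    exact ⟨i, hγσ, rfl⟩
  · rintro _ ⟨i, hi, rfl⟩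
    exact hi

variable (hb : ∀ i, b i ≠ 0) (ht : 1 < t)
include hb ht

/-- Every monomial in the ideal is a multiple of some `z_i ^ b i`, and `simplexFunctional` increases
in each coordinate. Hence its value at `x - 1` is at least `1` on the polyhedron, with equality
exactly on `Δ`. -/
theorem simplex_mem_boundedFaces : simplex b t ∈ boundedFaces (powerIdeal b) t := by
  have hv : ∀ i, expPoint t (Finsupp.single i (b i)) ∈ polyhedron (powerIdeal b) t := fun i =>
    subset_convexHull ℝ _ ⟨_, monomial_mem_powerIdeal_iff.2 ⟨i, le_rfl⟩, rfl⟩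
  have hsub : simplex b t ⊆ polyhedron (powerIdeal b) t := by
    refine convexHull_min ?_ (convex_convexHull ℝ _)
    rintro _ ⟨i, rfl⟩
    exact hv i
  refine ⟨?_, ((Set.finite_range _).isCompact_convexHull ℝ).isBounded⟩
  rintro ⟨x₀, hx₀⟩
  have hge : ∀ x ∈ polyhedron (powerIdeal b) t, 1 ≤ simplexFunctional b t (x - 1) := by
    intro x hx
    refine convexHull_min ?_ (convex_le_functional_sub _ _ _) hx
    rintro _ ⟨α, hα, rfl⟩
    obtain ⟨i, hi⟩ := monomial_mem_powerIdeal_iff.1 hα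
    have h := (functional_le ht (l := -simplexFunctional b t) (fun j => by
      simpa using simplexFunctional_single_pos hb ht j) hi).1
    have h2 := simplexFunctional_vertex hb ht i
    simp only [neg_apply, map_sub, Set.mem_ofPred_eq] at *
    linarith
  refine ⟨-simplexFunctional b t, Set.ext fun x => ⟨fun hx => ⟨hsub hx, fun y hy => ?_⟩, ?_⟩⟩
  · have h1 := ((mem_simplex hb ht).1 hx).2
    have h2 := hge y hy
    simp only [neg_apply, map_sub] at *
    linarith
  · rintro ⟨hx, hx'⟩
    refine (mem_simplex hb ht).2 ⟨one_le_of_mem_polyhedron ht hx, le_antisymm ?_ (hge x hx)⟩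
    have h1 := ((mem_simplex hb ht).1 hx₀).2
    have h2 := hx' x₀ (hsub hx₀)
    simp only [neg_apply, map_sub] at *
    linarith

theorem support_hull_powerIdeal : (hull (powerIdeal b) t ht).support = simplex b t := by
  refine Set.Subset.antisymm ?_
    (Set.subset_sUnion_of_mem (simplex_mem_boundedFaces hb ht))
  refine Set.sUnion_subset fun σ hσ => ?_
  rw [boundedFace_powerIdeal_eq ht hσ]
  exact convexHull_mono (Set.image_subset_range _ _)

/-- The vertex is the face of `Δ` on which all coordinates except the `i`-th are `1`. -/
theorem vertex_mem_hull_powerIdeal (i : Fin n) :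
    expPoint t (Finsupp.single i (b i)) ∈ (hull (powerIdeal b) t ht).vertices := by
  refine face_mem_boundedFaces ht (simplex_mem_boundedFaces hb ht) ?_
  have h := isExposed_coordinates (A := simplex b t) (fun x hx => ((mem_simplex hb ht).1 hx).1) {i}
  convert h using 1
  ext x
  rw [Set.mem_ofPred_eq, mem_simplex hb ht, and_assoc, ← mem_convexHull_vertices hb ht,
    Set.image_singleton, convexHull_singleton]

theorem label_hull_powerIdeal (i : Fin n) :
    (hull (powerIdeal b) t ht).label ⟨_, vertex_mem_hull_powerIdeal hb ht i⟩ =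
      Finsupp.single i (b i) :=
  expPoint_injective ht (exists_generator_of_vertex ht
    (vertex_mem_hull_powerIdeal hb ht i)).choose_spec.2

end PowerIdeal

end HullComplex

/-! ### The hull complex of `M` seen from the point `1` -/

namespace HullComplex

variable {n : ℕ} {M : Ideal (MvPolynomial (Fin n) ℂ)} {b : Fin n → ℕ} {t : ℝ}

theorem monomial_zero_notMem (h : M ≠ ⊤) : MvPolynomial.monomial 0 (1 : ℂ) ∉ M := fun h0 =>
  h ((Ideal.eq_top_iff_one M).2 h0)

/-- The condition is convex, so generating points suffice; there it could fail only for `t ^ 0 = 1`,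
which properness of `M` excludes. -/
theorem simplexFunctional_sub_one_pos_of_mem_polyhedron (hM : M ≠ ⊤) (hb : ∀ i, b i ≠ 0)
    (ht : 1 < t) {x : Fin n → ℝ} (hx : x ∈ polyhedron M t) :
    0 < simplexFunctional b t (x - 1) := by
  have hconv : Convex ℝ {x : Fin n → ℝ | 0 < simplexFunctional b t (x - 1)} := by
    intro x hx y hy p q hp hq hpq
    exact (centralProj_combo hx hy hp hq hpq).1.trans_eq (by
      obtain rfl : q = 1 - p := by linarith
      rw [← smul_eq_mul, ← smul_eq_mul, ← map_smul, ← map_smul, ← map_add]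
      congr 1
      module)
  refine convexHull_min ?_ hconv hx
  rintro _ ⟨α, hα, rfl⟩
  refine functional_pos (simplexFunctional_single_pos hb ht)
    (fun i => sub_nonneg.2 (one_le_expPoint ht α i)) fun h => ?_
  have h1 : expPoint t α = expPoint t 0 := by
    rw [sub_eq_zero.1 h]
    funext i
    simp [expPoint]
  rw [expPoint_injective ht h1] at hα
  exact monomial_zero_notMem hM hα

theorem support_hull_subset (ht : 1 < t) : (hull M t ht).support ⊆ polyhedron M t :=
  Set.sUnion_subset fun _ hF => hF.1.subset

theorem exists_functional_of_boundedFace (ht : 1 < t) {F : Set (Fin n → ℝ)}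
    (hF : F ∈ boundedFaces M t) (hne : F.Nonempty) : ∃ l : StrongDual ℝ (Fin n → ℝ),
      (∀ i, l (Pi.single i 1) < 0) ∧ F = {x ∈ polyhedron M t | ∀ y ∈ polyhedron M t, l y ≤ l x} := by
  obtain ⟨x, hx⟩ := hne
  obtain ⟨l, rfl⟩ := hF.1 ⟨x, hx⟩
  exact ⟨l, neg_of_bounded ht hx hF.2, rfl⟩

theorem functional_sub_one_neg (hM : M ≠ ⊤) (ht : 1 < t) {l : StrongDual ℝ (Fin n → ℝ)}
    (hl : ∀ i, l (Pi.single i 1) < 0) {x : Fin n → ℝ} (hx : x ∈ polyhedron M t) :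
    l (x - 1) < 0 := by
  have h := functional_pos (l := -l) (fun i => by simpa using hl i) (x := x - 1)
    (fun i => sub_nonneg.2 (one_le_of_mem_polyhedron ht hx i)) (fun h => by
      -- Only `x ≠ 1` is wanted, so any nonzero exponents would do.
      have := simplexFunctional_sub_one_pos_of_mem_polyhedron (b := fun _ => 1) hM
        (fun _ => one_ne_zero) ht hx
      rw [h, map_zero] at this
      exact this.false)
  simpa only [neg_apply, neg_pos] using h

/-- A supporting functional is constant on its face, and strictly negative relative to `1`. This is
the hypothesis `hplane` of `mapCentralProj`. -/
theorem boundedFace_subset_hyperplane (hM : M ≠ ⊤) (ht : 1 < t) {F : Set (Fin n → ℝ)}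
    (hF : F ∈ boundedFaces M t) :
    ∃ (l : StrongDual ℝ (Fin n → ℝ)) (k : ℝ), k ≠ 0 ∧ ∀ x ∈ F, l (x - 1) = k := by
  rcases F.eq_empty_or_nonempty with rfl | ⟨x, hx⟩
  · exact ⟨0, 1, one_ne_zero, by simp⟩
  obtain ⟨l, hl, rfl⟩ := exists_functional_of_boundedFace ht hF ⟨x, hx⟩
  refine ⟨l, l (x - 1), (functional_sub_one_neg hM ht hl hx.1).ne, fun y hy => ?_⟩
  rw [map_sub, map_sub, le_antisymm (hx.2 y hy.1) (hy.2 x hx.1)]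

/-- A ray from `1` meets the union of the bounded faces at most once. -/
theorem injOn_centralProj (hM : M ≠ ⊤) (hb : ∀ i, b i ≠ 0) (ht : 1 < t) :
    Set.InjOn (centralProj 1 (simplexFunctional b t)) (hull M t ht).support := by
  have hpos := fun x (hx : x ∈ (hull M t ht).support) =>
    simplexFunctional_sub_one_pos_of_mem_polyhedron hM hb ht (support_hull_subset ht hx)
  -- If `l` supports a face through `q`, then `l (p - 1) ≤ l (q - 1) < 0`. Both vectors are positive
  -- multiples of one vector on which `l` is negative, so `q` is no farther from `1` than `p`.
  have key : ∀ p ∈ (hull M t ht).support, ∀ q ∈ (hull M t ht).support,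
      centralProj 1 (simplexFunctional b t) p = centralProj 1 (simplexFunctional b t) q →
      simplexFunctional b t (q - 1) ≤ simplexFunctional b t (p - 1) := by
    rintro p hp q hq h
    obtain ⟨F, hF, hqF⟩ := id hq
    obtain ⟨l, hl, rfl⟩ := exists_functional_of_boundedFace ht hF ⟨q, hqF⟩
    have h1 := hqF.2 p (support_hull_subset ht hp)
    have h2 := functional_sub_one_neg hM ht hl (support_hull_subset ht hp)
    have e1 := congrArg l (smul_centralProj_sub (hpos p hp))
    have e2 := congrArg l (smul_centralProj_sub (hpos q hq))
    rw [map_smul, smul_eq_mul] at e1 e2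
    rw [← h] at e2
    have h3 : l (centralProj 1 (simplexFunctional b t) p - 1) < 0 := by
      rw [← e1] at h2
      exact (pos_iff_neg_of_mul_neg h2).1 (hpos p hp)
    have h4 : l (p - 1) ≤ l (q - 1) := by
      rw [map_sub, map_sub]
      linarith
    rw [← e1, ← e2] at h4
    exact (mul_le_mul_right_of_neg h3).1 h4
  intro p hp q hq h
  have e := le_antisymm (key q hq p hp h.symm) (key p hp q hq h)
  have h1 := smul_centralProj_sub (hpos p hp)
  rw [e, h, smul_centralProj_sub (hpos q hq)] at h1
  exact (sub_left_inj.1 h1).symm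

/-- The line through `1` and a point of the polyhedron meets the simplex `Δ` in one point. -/
theorem line_inter_simplex (hM : M ≠ ⊤) (hb : ∀ i, b i ≠ 0) (ht : 1 < t) {p : Fin n → ℝ}
    (hp : p ∈ polyhedron M t) :
    (line[ℝ, (1 : Fin n → ℝ), p] : Set (Fin n → ℝ)) ∩ simplex b t =
      {centralProj 1 (simplexFunctional b t) p} := by
  have hpos := simplexFunctional_sub_one_pos_of_mem_polyhedron hM hb ht hp
  have e : ∀ r : ℝ, AffineMap.lineMap (1 : Fin n → ℝ) p r = 1 + r • (p - 1) := fun r => by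
    rw [AffineMap.lineMap_apply, vsub_eq_sub, vadd_eq_add, add_comm]
  ext x
  rw [Set.mem_inter_iff, SetLike.mem_coe, mem_affineSpan_pair_iff_exists_lineMap_eq, mem_simplex hb ht,
    Set.mem_singleton_iff]
  constructor
  · rintro ⟨⟨r, rfl⟩, -, h⟩
    rw [e, add_sub_cancel_left, map_smul, smul_eq_mul] at h
    rw [e, centralProj, eq_inv_of_mul_eq_one_left h]
  · rintro rfl
    refine ⟨⟨_, e _⟩, fun i => ?_, ?_⟩
    · have := mul_nonneg (inv_pos.2 hpos).le (sub_nonneg.2 (one_le_of_mem_polyhedron ht hp i))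
      simpa [centralProj] using this
    · rw [centralProj, add_sub_cancel_left, map_smul, smul_eq_mul, inv_mul_cancel₀ hpos.ne']

theorem centralProj_mem_simplex (hM : M ≠ ⊤) (hb : ∀ i, b i ≠ 0) (ht : 1 < t) {p : Fin n → ℝ}
    (hp : p ∈ polyhedron M t) : centralProj 1 (simplexFunctional b t) p ∈ simplex b t :=
  ((line_inter_simplex hM hb ht hp).symm.subset rfl).2

/-- The projection multiplies `p - 1` by a positive factor, so it respects the coordinate
hyperplanes through `1`. -/
theorem centralProj_apply_eq_one_iff (hM : M ≠ ⊤) (hb : ∀ i, b i ≠ 0) (ht : 1 < t)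
    {p : Fin n → ℝ} (hp : p ∈ polyhedron M t) (i : Fin n) :
    centralProj 1 (simplexFunctional b t) p i = 1 ↔ p i = 1 := by
  have hpos := simplexFunctional_sub_one_pos_of_mem_polyhedron hM hb ht hp
  simp only [centralProj, Pi.add_apply, Pi.one_apply, Pi.smul_apply, Pi.sub_apply, smul_eq_mul,
    add_eq_left, mul_eq_zero, inv_eq_zero, hpos.ne', false_or, sub_eq_zero]

/-- A ray from `1` in a strictly positive direction meets a bounded face. -/
theorem exists_ray_mem_support [Nonempty (Fin n)] (hM : M ≠ ⊤)
    (hgen : ∀ i, IsMinimalGenerator M (Finsupp.single i (b i))) (ht : 1 < t) {d : Fin n → ℝ}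
    (hd : ∀ i, 0 < d i) : ∃ s : ℝ, 0 < s ∧ 1 + s • d ∈ (hull M t ht).support := by
  set Q : Set (Fin n → ℝ) := convexHull ℝ (expPoint t '' {γ | IsMinimalGenerator M γ}) with hQ
  have hQc : IsCompact Q := ((finite_minimalGenerators M).image _).isCompact_convexHull ℝ
  have hQP : Q ⊆ polyhedron M t := convexHull_mono (Set.image_mono fun γ hγ => hγ.1)
  have hv : ∀ i, expPoint t (Finsupp.single i (b i)) ∈ Q := fun i =>
    subset_convexHull ℝ _ ⟨_, hgen i, rfl⟩
  have hu : (Finset.univ : Finset (Fin n)).Nonempty := Finset.univ_nonempty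
  -- `g y` is the least `s` for which `1 + s • d` dominates `y`. Its minimum over `Q` gives the
  -- first point `q` of the ray that dominates a point of `Q`.
  set g : (Fin n → ℝ) → ℝ := fun y => Finset.univ.sup' hu fun i => (y i - 1) / d i with hg
  have hgc : Continuous g := Continuous.finset_sup'_apply hu fun i _ => by fun_prop
  obtain ⟨y, hyQ, hymin⟩ := hQc.exists_isMinOn ⟨_, hv (Classical.arbitrary _)⟩ hgc.continuousOn
  set s := g y with hs
  set q : Fin n → ℝ := 1 + s • d with hq
  have hqi : ∀ i, q i = 1 + s * d i := fun i => by simp [hq]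
  have hyq : ∀ i, y i ≤ q i := by
    intro i
    have : (y i - 1) / d i ≤ s := Finset.le_sup' (fun i => (y i - 1) / d i) (Finset.mem_univ i)
    rw [div_le_iff₀ (hd i)] at this
    rw [hqi]
    linarith
  have hspos : 0 < s := by
    by_contra! hs0
    have hy1 : y = 1 := by
      funext i
      refine le_antisymm ((hyq i).trans ?_) (one_le_of_mem_polyhedron ht (hQP hyQ) i)
      rw [hqi, Pi.one_apply]
      nlinarith [hd i]
    have := simplexFunctional_sub_one_pos_of_mem_polyhedron (b := fun _ => 1) hM
      (fun _ => one_ne_zero) ht (hQP hyQ)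
    rw [hy1, sub_self, map_zero] at this
    exact this.false
  set U : Set (Fin n → ℝ) := Set.univ.pi fun i => Set.Iio (q i) with hU
  have hdisj : Disjoint U Q := by
    refine Set.disjoint_left.2 fun x hxU hxQ => ?_
    have h1 : s ≤ g x := hymin hxQ
    refine h1.not_gt ((Finset.sup'_lt_iff hu).2 fun i _ => ?_)
    have := hxU i (Set.mem_univ i)
    rw [div_lt_iff₀ (hd i)]
    rw [Set.mem_Iio, hqi] at this
    linarith
  obtain ⟨f, u, hfU, hfQ⟩ := geometric_hahn_banach_open (convex_pi fun i _ => convex_Iio (q i))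
    (isOpen_set_pi Set.finite_univ fun i _ => isOpen_Iio) (convex_convexHull ℝ _) hdisj
  -- The bound on the open orthant `U` passes to its closure, which contains `y` and `q`.
  have hle : ∀ x : Fin n → ℝ, (∀ i, x i ≤ q i) → f x ≤ u := by
    intro x hx
    have hlim : Tendsto (fun ε : ℝ => f x - ε * f 1) (𝓝[>] 0) (𝓝 (f x)) := by
      have : Tendsto (fun ε : ℝ => f x - ε * f 1) (𝓝 0) (𝓝 (f x - 0 * f 1)) :=
        Continuous.tendsto (by fun_prop) 0
      simpa using this.mono_left nhdsWithin_le_nhds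
    refine le_of_tendsto hlim ?_
    filter_upwards [self_mem_nhdsWithin] with ε hε
    have h := hfU (x - ε • 1) fun i _ => by
      have : (0 : ℝ) < ε := hε
      have := hx i
      simp only [Pi.sub_apply, Pi.smul_apply, Pi.one_apply, smul_eq_mul, mul_one, Set.mem_Iio]
      linarith
    rw [map_sub, map_smul, smul_eq_mul] at h
    exact h.le
  have hfy : f y = u := le_antisymm (hle y hyq) (hfQ y hyQ)
  have hfq : f q ≤ u := hle q fun _ => le_rfl
  -- Lowering a coordinate of `y` stays below `q`, so it cannot raise `f` above `u = f y`.
  have hnonneg : ∀ i, 0 ≤ f (Pi.single i 1) := by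
    intro i
    have h := hle (y - Pi.single i 1) fun j => by
      have : (0 : ℝ) ≤ (Pi.single i 1 : Fin n → ℝ) j := by
        rw [Pi.single_apply]; split_ifs <;> norm_num
      have := hyq j
      simp only [Pi.sub_apply]
      linarith
    rw [map_sub, hfy] at h
    linarith
  have hf_sub : 0 ≤ f (q - y) := by
    rw [functional_apply_eq_sum]
    exact Finset.sum_nonneg fun i _ => mul_nonneg (sub_nonneg.2 (hyq i)) (hnonneg i)
  have hfq' : f q = u := by
    rw [map_sub] at hf_sub
    linarith
  have hf1 : 0 < f 1 := by
    have h := hfU (q - 1) fun i _ => by simp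
    rw [map_sub, hfq'] at h
    linarith
  have hfd : 0 < f d := by
    obtain ⟨j, hj⟩ : ∃ j, 0 < f (Pi.single j 1) := by
      by_contra! hc
      rw [functional_apply_eq_sum] at hf1
      refine hf1.not_ge (Finset.sum_nonpos fun i _ => ?_)
      simpa using hc i
    rw [functional_apply_eq_sum]
    exact Finset.sum_pos' (fun i _ => mul_nonneg (hd i).le (hnonneg i))
      ⟨j, Finset.mem_univ j, mul_pos (hd j) hj⟩
  -- If `f` ignored direction `i`, it would equal `f 1` at the point of `z_i ^ b i` in `Q`, below `u
  -- = f 1 + s * f d`.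
  have hfpos : ∀ i, 0 < f (Pi.single i 1) := by
    refine fun i => lt_of_le_of_ne (hnonneg i) fun h0 => ?_
    have h1 := hfQ _ (hv i)
    rw [expPoint_single, map_add, map_smul, ← h0, smul_zero, add_zero, ← hfq', hq, map_add,
      map_smul, smul_eq_mul] at h1
    have := mul_pos hspos hfd
    linarith
  -- A strictly positive functional vanishing on `q - y ≥ 0` forces equality, so the ray point
  -- itself lies in `Q`.
  have hqy : q = y := by
    by_contra hne
    have h := functional_pos hfpos (x := q - y) (fun i => sub_nonneg.2 (hyq i))
      (sub_ne_zero.2 hne)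
    rw [map_sub, hfq', hfy, sub_self] at h
    exact h.false
  have hneg : ∀ i, (-f) (Pi.single i 1) < 0 := fun i => by simpa using hfpos i
  have hmax : ∀ γ, IsMinimalGenerator M γ → (-f) (expPoint t γ) ≤ -u := fun γ hγ =>
    neg_le_neg (hfQ _ (subset_convexHull ℝ _ ⟨γ, hγ, rfl⟩))
  have hval : (-f) q = -u := by rw [neg_apply, hfq']
  have hqP : q ∈ polyhedron M t := hqy ▸ hQP hyQ
  refine ⟨s, hspos, {x ∈ polyhedron M t | ∀ y ∈ polyhedron M t, (-f) y ≤ (-f) x},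
    ⟨fun _ => ⟨-f, rfl⟩, hQc.isBounded.subset fun x hx => ?_⟩,
    hqP, fun x hx => ?_⟩
  · exact convexHull_mono (Set.image_mono fun γ hγ => hγ.1)
      ((argmax_eq_convexHull ht hneg hmax hx.1).2 (hval ▸ hx.2 q hqP))
  · exact (argmax_eq_convexHull ht hneg hmax hx).1.trans_eq hval.symm

/-- The ray lemma covers only strictly positive directions. A general point of `Δ` is the limit of
the projections of `x + ε • 1`, and the image is compact, hence closed. -/
theorem image_centralProj_support (hM : M ≠ ⊤) (hb : ∀ i, b i ≠ 0)
    (hgen : ∀ i, IsMinimalGenerator M (Finsupp.single i (b i))) (ht : 1 < t) :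
    centralProj 1 (simplexFunctional b t) '' (hull M t ht).support = simplex b t := by
  have hpos := fun x (hx : x ∈ (hull M t ht).support) =>
    simplexFunctional_sub_one_pos_of_mem_polyhedron hM hb ht (support_hull_subset ht hx)
  refine Set.Subset.antisymm ?_ fun x hx => ?_
  · rintro _ ⟨p, hp, rfl⟩
    exact centralProj_mem_simplex hM hb ht (support_hull_subset ht hp)
  obtain ⟨hx1, hx2⟩ := (mem_simplex hb ht).1 hx
  -- For `n = 0` the functional is zero, so `Δ` is empty.
  have : Nonempty (Fin n) := by
    by_contra hc
    rw [not_nonempty_iff] at hc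
    rw [Subsingleton.elim (x - 1) 0, map_zero] at hx2
    exact zero_ne_one hx2
  have hclosed : IsClosed (centralProj 1 (simplexFunctional b t) '' (hull M t ht).support) :=
    ((hull M t ht).isCompact_support.image_of_continuousOn
      (continuousOn_centralProj.mono hpos)).isClosed
  have hxpos : 0 < simplexFunctional b t (x - 1) := hx2 ▸ one_pos
  have hfix : centralProj 1 (simplexFunctional b t) x = x := by
    rw [centralProj, hx2, inv_one, one_smul, add_sub_cancel]
  have hopen : IsOpen {x | 0 < simplexFunctional b t (x - 1)} :=
    isOpen_lt continuous_const (by fun_prop)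
  have hcont : ContinuousAt (centralProj 1 (simplexFunctional b t)) x :=
    continuousOn_centralProj.continuousAt (hopen.mem_nhds hxpos)
  have hlim : Tendsto (fun ε : ℝ => x + ε • 1) (𝓝[>] 0) (𝓝 x) := by
    have : Tendsto (fun ε : ℝ => x + ε • 1) (𝓝 0) (𝓝 (x + (0 : ℝ) • 1)) :=
      Continuous.tendsto (by fun_prop) 0
    rw [zero_smul, add_zero] at this
    exact this.mono_left nhdsWithin_le_nhds
  have hlim' := hcont.tendsto.comp hlim
  rw [hfix] at hlim'
  refine hclosed.mem_of_tendsto hlim' ?_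
  filter_upwards [self_mem_nhdsWithin] with ε hε
  have hε : 0 < ε := hε
  obtain ⟨s, hs, hmem⟩ := exists_ray_mem_support hM hgen ht (d := x + ε • 1 - 1) fun i => by
    have := hx1 i
    simp only [Pi.sub_apply, Pi.add_apply, Pi.smul_apply, Pi.one_apply, smul_eq_mul, mul_one]
    linarith
  refine ⟨_, hmem, ?_⟩
  rw [Function.comp_apply, centralProj, centralProj, add_sub_cancel_left, map_smul, smul_eq_mul,
    smul_smul, mul_inv, mul_right_comm, inv_mul_cancel₀ hs.ne', one_mul]

end HullComplex

/-! ### The refinement and the comparison of labels -/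

open HullComplex in
theorem proposition3p2 (n : ℕ) (M : Ideal (MvPolynomial (Fin n) ℂ)) (b : Fin n → ℕ)
    (hmon : HullComplex.IsMonomialIdeal M) (hart : IsArtinianRing (MvPolynomial (Fin n) ℂ ⧸ M))
    (hproper : M ≠ ⊤) (hb : ∀ i, HullComplex.IsMinimalGenerator M (Finsupp.single i (b i))) :
    ∀ᶠ t : ℝ in atTop, ∀ ht : 1 < t,
      ∃ (π : (Fin n → ℝ) → (Fin n → ℝ)) (X : LabeledPolyhedralComplex (Fin n → ℝ) n),
        (∀ p ∈ (HullComplex.hull M t ht).support,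
          (line[ℝ, (1 : Fin n → ℝ), p] : Set (Fin n → ℝ)) ∩ HullComplex.simplex b t = {π p}) ∧
        LabeledPolyhedralComplex.IsEmbedding π (HullComplex.hull M t ht) X ∧
        X.Refines (HullComplex.hull (HullComplex.powerIdeal b) t ht) := by
  refine Eventually.of_forall fun t ht => ?_
  have hb0 : ∀ i, b i ≠ 0 := fun i h => monomial_zero_notMem hproper (by
    simpa [h] using (hb i).1)
  have hmem := support_hull_subset (M := M) ht
  have hface : ∀ τ ∈ (hull M t ht).faces, ∀ x ∈ τ, x ∈ polyhedron M t := fun τ hτ x hx =>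
    hmem ⟨τ, hτ, hx⟩
  have hpos := fun x (hx : x ∈ (hull M t ht).support) =>
    simplexFunctional_sub_one_pos_of_mem_polyhedron hproper hb0 ht (hmem hx)
  refine ⟨centralProj 1 (simplexFunctional b t), (hull M t ht).mapCentralProj hpos
    (injOn_centralProj hproper hb0 ht) fun σ hσ => boundedFace_subset_hyperplane hproper ht hσ,
    fun p hp => line_inter_simplex hproper hb0 ht (hmem hp),
    LabeledPolyhedralComplex.isEmbedding_mapCentralProj, ⟨?_, fun σ hσ => ?_⟩, ?_⟩
  · rw [LabeledPolyhedralComplex.support_mapCentralProj,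
      image_centralProj_support hproper hb0 hb ht, support_hull_powerIdeal hb0 ht]
  · refine ⟨{ρ ∈ (fun τ => centralProj 1 (simplexFunctional b t) '' τ) '' (hull M t ht).faces |
      ρ ⊆ σ}, fun ρ hρ => hρ.1, Set.Subset.antisymm (fun x hx => ?_)
      (Set.sUnion_subset fun ρ hρ => hρ.2)⟩
    have hσeq := boundedFace_powerIdeal_eq ht hσ
    set J := {i | expPoint t (Finsupp.single i (b i)) ∈ σ}
    have hmemσ := fun y => (Set.ext_iff.1 hσeq y).trans (mem_convexHull_vertices hb0 ht J)
    have hxJ := (hmemσ x).1 hx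
    have hxΔ : x ∈ simplex b t := (mem_simplex hb0 ht).2 ⟨hxJ.1, hxJ.2.1⟩
    rw [← image_centralProj_support hproper hb0 hb ht] at hxΔ
    obtain ⟨p, ⟨τ, hτ, hpτ⟩, rfl⟩ := hxΔ
    -- The part of `τ` over `σ` is where the coordinates outside `J` equal `1`: a face of `τ`,
    -- containing `p`, whose image lies in `σ`.
    refine ⟨centralProj 1 (simplexFunctional b t) '' {y ∈ τ | ∀ j ∉ J, y j = 1},
      ⟨⟨_, (hull M t ht).face_mem τ hτ _ (isExposed_coordinates (fun y hy =>
        one_le_of_mem_polyhedron ht (hface τ hτ y hy)) J), rfl⟩, ?_⟩,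
      p, ⟨hpτ, fun j hj => ?_⟩, rfl⟩
    · rintro _ ⟨y, ⟨hy, hyJ⟩, rfl⟩
      have hyP := hface τ hτ y hy
      obtain ⟨h1, h2⟩ := (mem_simplex hb0 ht).1 (centralProj_mem_simplex hproper hb0 ht hyP)
      exact (hmemσ _).2 ⟨h1, h2, fun j hj =>
        (centralProj_apply_eq_one_iff hproper hb0 ht hyP j).2 (hyJ j hj)⟩
    · exact (centralProj_apply_eq_one_iff hproper hb0 ht (hface τ hτ p hpτ) j).1
        (hxJ.2.2 j hj)
  · intro σ' _ σ hσ hsub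
    refine Finset.sup_le fun w hw => ?_
    have hwσ : (w : Fin n → ℝ) ∈ σ := hsub (by simpa using hw)
    obtain ⟨v, hvw, e⟩ := LabeledPolyhedralComplex.exists_vertex_mapCentralProj w
    rw [e]
    obtain ⟨hγ, hγv⟩ := (exists_generator_of_vertex ht v.2).choose_spec
    change IsMinimalGenerator M ((hull M t ht).label v) at hγ
    change expPoint t ((hull M t ht).label v) = v at hγv
    set γ := (hull M t ht).label v
    rw [boundedFace_powerIdeal_eq ht hσ, mem_convexHull_vertices hb0 ht] at hwσ
    intro i
    by_cases hi : expPoint t (Finsupp.single i (b i)) ∈ σ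
    · have h1 : Finsupp.single i (b i) ≤ (hull (powerIdeal b) t ht).faceLabel σ := by
        rw [← label_hull_powerIdeal hb0 ht i]
        exact Finset.le_sup (f := (hull (powerIdeal b) t ht).label) (by simpa using hi)
      have h2 := h1 i
      rw [Finsupp.single_eq_same] at h2
      refine le_trans ?_ h2
      -- If `b i < γ i`, then `z_i ^ b i` would properly divide the minimal generator `z ^ γ`.
      by_contra! hlt
      have h3 : Finsupp.single i (b i) ≤ γ := Finsupp.single_le_iff.2 hlt.le
      have h4 := hγ.le_of_le (hb i).1 h3 i
      rw [Finsupp.single_eq_same] at h4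
      omega
    -- Off the index set of `σ` the projected vertex has coordinate `1`, hence so does `t ^ γ`, and
    -- `γ i = 0`.
    · have h1 := hwσ.2.2 i hi
      rw [← hvw, centralProj_apply_eq_one_iff hproper hb0 ht (hface _ v.2 _ rfl), ← hγv] at h1
      have h2 : γ i = 0 := by
        by_contra hne
        exact (pow_sub_one_pos ht hne).ne' (sub_eq_zero.2 h1)
      rw [h2]
      exact Nat.zero_le _
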